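/- **Setting.** Fix a number of units $N\ge 1$, a number $J$ of outcome variables, a horizon $k\ge 0$, a variable index $s\in\{1,\dots,J+1\}$ and a level $\alpha\in(0,1)$. For each $T$ let $\mathcal P_T$ be a probability distribution of a panel $\{x_{i,t},Z_{i,t}\}$ with units $i\le N$ and periods $t\le T$, where $x_{i,t}\in\mathbb R^{J+1}$ contains the policy variable in position $1$ and the $J$ outcomes after it, and $Z_{i,t}\in\mathbb R$ is the instrument. Let $$x_{i,t}=(I-\Phi)\mu_i+\Phi x_{i,t-1}+\tilde x_{i,t},\qquad \tilde x_{i,t}=(\widetilde W_{i,t},\widetilde Y_{1,i,t},\dots,\widetilde Y_{J,i,t})',$$ with $\Phi$ fixed, while the fixed effects $\mu_i$ may depend on $T$. The innovations are generated by potential innovations: $\widetilde W_{i,t}=\widetilde W_{i,t}(Z_{i,t})$ and $\widetilde Y_{j,i,t}=\widetilde Y_{j,i,t}(\widetilde W_{i,t},Z_{i,t})$ almost surely. Under $\mathcal P_T$ the innovations and the instrument are square integrable, $\mathbb E\tilde x_{i,t}=0$, and the second moments $\Sigma_T=\operatorname{Var}(\tilde x_{i,t})$, $\Gamma_T=\operatorname{cov}(Z_{i,t},\tilde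 x_{i,t})$ and $\operatorname{Var}(Z_{i,t})=\sigma_Z^2$ do not depend on $i,t$; moreover $\sigma_Z^2$ does not depend on $T$. Write $\delta_T=e_1'\Gamma_T=\operatorname{cov}(Z_{i,t},\widetilde W_{i,t})$. Let $C_k(\Phi)=\Phi^k$ and $$H_T=\begin{pmatrix} e_s'C_k(\Phi)\Gamma_T\\ e_1'\Gamma_T\end{pmatrix},\qquad \hat H_T=\begin{pmatrix} e_s'C_k(\hat\Phi_T)\hat\Gamma_T\\ e_1'\hat\Gamma_T\end{pmatrix},$$ where $\hat\Phi_T,\hat\Gamma_T$ are estimators (functions of the observed sample). The impulse response of variable $s$ at horizon $k$ is the ratio $\lambda_{k,s}$ of the two entries of $H_T$, and $\hat\lambda_T=\hat H_{T,1}/\hat H_{T,2}$. Let $\hat V_T$, a function of the sample with values in the positive semidefinite $2\times2$ matrices, be an estimator of the asymptotic covariance matrix $V$ of $\hat H_T$, and put $$\hat\sigma_T^2(\lambda)=(1,-\lambda)\hat V_T(1,-\lambda)',\qquad \sigma^2(\lambda)=(1,-\lambda)V(1,-\lambda)'.$$ Let $z_{1-\alpha/2}$ be the standard normal quantile. The confidence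 sets are $$\mathrm{CS}^{\mathrm{AR}}_T(1-\alpha)=\Bigl\{\lambda\in\mathbb R:\ \bigl[\sqrt T(\hat H_{T,1}-\lambda\hat H_{T,2})\bigr]^2\le z_{1-\alpha/2}^2\,\hat\sigma_T^2(\lambda)\Bigr\},$$ $$\mathrm{CS}^{\text{Plug-in}}_T(1-\alpha)=\Bigl[\hat\lambda_T-z_{1-\alpha/2}\frac{\hat\sigma_{T,k,s}}{\sqrt T},\ \hat\lambda_T+z_{1-\alpha/2}\frac{\hat\sigma_{T,k,s}}{\sqrt T}\Bigr],$$ where $\hat\sigma_{T,k,s}^2=g'\hat V_Tg$ is the delta-method variance, with $g=(1/\hat H_{T,2},\,-\hat H_{T,1}/\hat H_{T,2}^2)'$ the gradient of the ratio at $\hat H_T$. **Proposition.** Suppose that (i) for all $i,j,t$ and all real $w,z,z'$: (independence) $(\widetilde Y_{j,i,t}(w,z),\widetilde W_{i,t}(z))$ is independent of $Z_{i,t}$; (exclusion) $\widetilde Y_{j,i,t}(w,z)=\widetilde Y_{j,i,t}(w,z')$ almost surely; (monotonicity) $\widetilde W_{i,t}(z)\ge\widetilde W_{i,t}(z')$ almost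 surely or $\widetilde W_{i,t}(z)\le\widetilde W_{i,t}(z')$ almost surely; (ii) $\delta_T\to\delta$ with $\delta\ne0$ (relevance); (iii) $\Sigma_T\to\Sigma$; (iv) the variance estimator is consistent: $\hat\sigma_T^2(\lambda)\xrightarrow{p}\sigma^2(\lambda)$ for every $\lambda\in\mathbb R$; (v) $\sqrt T(\hat H_T-H_T)\xrightarrow{d}N(0,V)$ for a positive semidefinite matrix $V$. Then, with $d_H$ the Hausdorff distance between subsets of $\mathbb R$ (with values in $[0,\infty]$), $$\sqrt T\,d_H\bigl(\mathrm{CS}^{\mathrm{AR}}_T(1-\alpha),\mathrm{CS}^{\text{Plug-in}}_T(1-\alpha)\bigr)\xrightarrow{p}0 .$$ -/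

import Mathlib

open MeasureTheory ProbabilityTheory Filter Topology
open scoped ENNReal Matrix

/-- A panel of `N` units and `T` periods, with one policy variable and `J` outcome variables.
Coordinate `0` of `x i t` is the policy variable, coordinate `j + 1` is outcome `j`.
The vector `x i 0` is the initial observation; the instrument `Z i t` and the potential
innovations `Wpot i t`, `Ypot j i t` with `t : Fin T` belong to the same period as `x i t.succ`. -/
structure Panel (N J T : ℕ) (Ω : Type*) where
  /-- the observed variables -/
  x : Fin N → Fin (T + 1) → Ω → (Fin (J + 1) → ℝ)
  /-- the observed instrument -/
  Z : Fin N → Fin T → Ω → ℝ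
  /-- the potential policy innovations, as a function of the instrument -/
  Wpot : Fin N → Fin T → ℝ → Ω → ℝ
  /-- the potential outcome innovations, as a function of policy innovation and instrument -/
  Ypot : Fin J → Fin N → Fin T → ℝ → ℝ → Ω → ℝ

/-- The space of observed samples `({x i t}, {Z i t})`. -/
abbrev PanelSample (N J T : ℕ) : Type :=
  (Fin N → Fin (T + 1) → (Fin (J + 1) → ℝ)) × (Fin N → Fin T → ℝ)

namespace Panel

variable {N J T : ℕ} {Ω : Type*}

/-- The observed sample. -/
def sample (D : Panel N J T Ω) (ω : Ω) : PanelSample N J T :=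
  (fun i t => D.x i t ω, fun i t => D.Z i t ω)

/-- The innovation of the panel VAR
`x i t = (1 - Φ) μ i + Φ (x i (t - 1)) + innovation i t`. -/
def innovation (D : Panel N J T Ω) (Φ : Matrix (Fin (J + 1)) (Fin (J + 1)) ℝ)
    (μ : Fin N → Fin (J + 1) → ℝ) (i : Fin N) (t : Fin T) (ω : Ω) : Fin (J + 1) → ℝ :=
  D.x i t.succ ω - ((1 - Φ) *ᵥ μ i + Φ *ᵥ D.x i t.castSucc ω)

/-- The observed and potential quantities are random variables, and the realized innovations are
the potential ones at the realized instrument and the realized policy innovation. -/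
structure IsPotentialOutcomeModel [MeasurableSpace Ω] (D : Panel N J T Ω) (P : Measure Ω)
    (Φ : Matrix (Fin (J + 1)) (Fin (J + 1)) ℝ) (μ : Fin N → Fin (J + 1) → ℝ) : Prop where
  measurable_x : ∀ i t, Measurable (D.x i t)
  measurable_Z : ∀ i t, Measurable (D.Z i t)
  measurable_Wpot : ∀ i t z, Measurable (D.Wpot i t z)
  measurable_Ypot : ∀ j i t w z, Measurable (D.Ypot j i t w z)
  policy_eq : ∀ i t, ∀ᵐ ω ∂P, D.innovation Φ μ i t ω 0 = D.Wpot i t (D.Z i t ω) ω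
  outcome_eq : ∀ j i t, ∀ᵐ ω ∂P, D.innovation Φ μ i t ω (Fin.succ j) =
    D.Ypot j i t (D.innovation Φ μ i t ω 0) (D.Z i t ω) ω

/-- Independence: the potential innovations are independent of the instrument. -/
def Independence [MeasurableSpace Ω] (D : Panel N J T Ω) (P : Measure Ω) : Prop :=
  ∀ j i t w z, IndepFun (fun ω => (D.Ypot j i t w z ω, D.Wpot i t z ω)) (D.Z i t) P

/-- Exclusion: the instrument affects the outcomes only through the policy. -/
def Exclusion [MeasurableSpace Ω] (D : Panel N J T Ω) (P : Measure Ω) : Prop :=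
  ∀ j i t w z z', D.Ypot j i t w z =ᵐ[P] D.Ypot j i t w z'

/-- Monotonicity: for any two values of the instrument, one potential policy innovation
dominates the other. -/
def Monotonicity [MeasurableSpace Ω] (D : Panel N J T Ω) (P : Measure Ω) : Prop :=
  ∀ i t z z', D.Wpot i t z ≤ᵐ[P] D.Wpot i t z' ∨ D.Wpot i t z' ≤ᵐ[P] D.Wpot i t z

/-- The innovations are square integrable and centred, and the second moments of innovations and
instrument do not depend on unit and period: `Sig` is the covariance matrix of the innovations,
`Γ` the vector of their covariances with the instrument (so that `Γ 0` is the first-stage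
covariance `δ`), and `v` the variance of the instrument. -/
structure HasStationaryMoments [MeasurableSpace Ω] (D : Panel N J T Ω) (P : Measure Ω)
    (Φ : Matrix (Fin (J + 1)) (Fin (J + 1)) ℝ) (μ : Fin N → Fin (J + 1) → ℝ)
    (Sig : Matrix (Fin (J + 1)) (Fin (J + 1)) ℝ) (Γ : Fin (J + 1) → ℝ) (v : ℝ) : Prop where
  memLp_innovation : ∀ i t a, MemLp (fun ω => D.innovation Φ μ i t ω a) 2 P
  memLp_Z : ∀ i t, MemLp (D.Z i t) 2 P
  mean_innovation : ∀ i t a, ∫ ω, D.innovation Φ μ i t ω a ∂P = 0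
  cov_innovation : ∀ i t a b,
    covariance (fun ω => D.innovation Φ μ i t ω a) (fun ω => D.innovation Φ μ i t ω b) P = Sig a b
  cov_Z : ∀ i t a, covariance (D.Z i t) (fun ω => D.innovation Φ μ i t ω a) P = Γ a
  var_Z : ∀ i t, variance (D.Z i t) P = v

end Panel

/-- `H = (e_s' C_k(Φ) Γ, e_1' Γ)`, where `C_k(Φ) = Φ ^ k` is the `k`-th moving average coefficient
of the VAR(1). The ratio of its entries is the response of variable `s` at horizon `k`. -/
noncomputable def irfPair {J : ℕ} (s : Fin (J + 1)) (k : ℕ)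
    (Φ : Matrix (Fin (J + 1)) (Fin (J + 1)) ℝ) (Γ : Fin (J + 1) → ℝ) : EuclideanSpace ℝ (Fin 2) :=
  !₂[(Φ ^ k *ᵥ Γ) s, Γ 0]

/-- If `V` is the (asymptotic) covariance matrix of `√T (Ĥ - H)`, this is the (asymptotic) variance
of `√T ((Ĥ 0 - l Ĥ 1) - (H 0 - l H 1))`. -/
def arVariance (V : Matrix (Fin 2) (Fin 2) ℝ) (l : ℝ) : ℝ :=
  ![1, -l] ⬝ᵥ (V *ᵥ ![1, -l])

/-- The delta-method variance of `√T Ĥ 0 / Ĥ 1` at `h`: the quadratic form of `V` at the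
gradient `(1 / h 1, - h 0 / h 1 ^ 2)` of the ratio. -/
noncomputable def deltaVariance (V : Matrix (Fin 2) (Fin 2) ℝ) (h : EuclideanSpace ℝ (Fin 2)) : ℝ :=
  ![1 / h 1, -(h 0 / h 1 ^ 2)] ⬝ᵥ (V *ᵥ ![1 / h 1, -(h 0 / h 1 ^ 2)])

/-- The `p`-quantile of the standard normal distribution. -/
noncomputable def normalQuantile (p : ℝ) : ℝ :=
  sInf {z : ℝ | p ≤ cdf (gaussianReal 0 1) z}

/-- The level `1 - α` Anderson-Rubin confidence set: the values `l` for which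
`H 0 - l * H 1 = 0` is not rejected, given the estimates `h` of `H` and `V` of the asymptotic
covariance matrix. -/
noncomputable def arSet (T : ℕ) (α : ℝ) (h : EuclideanSpace ℝ (Fin 2))
    (V : Matrix (Fin 2) (Fin 2) ℝ) : Set ℝ :=
  {l : ℝ | (√(T : ℝ) * (h 0 - l * h 1)) ^ 2 ≤ normalQuantile (1 - α / 2) ^ 2 * arVariance V l}

/-- The level `1 - α` plug-in (delta-method) confidence interval. -/
noncomputable def plugInSet (T : ℕ) (α : ℝ) (h : EuclideanSpace ℝ (Fin 2))
    (V : Matrix (Fin 2) (Fin 2) ℝ) : Set ℝ :=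
  Set.Icc (h 0 / h 1 - normalQuantile (1 - α / 2) * √(deltaVariance V h) / √(T : ℝ))
    (h 0 / h 1 + normalQuantile (1 - α / 2) * √(deltaVariance V h) / √(T : ℝ))

/-- Convergence in probability to zero of nonnegative variables, the `T`-th of which lives on the
probability space `(Ω T, P T)`. -/
def TendstoInProbZero {Ω : ℕ → Type*} [∀ T, MeasurableSpace (Ω T)] (P : ∀ T, Measure (Ω T))
    (X : ∀ T, Ω T → ℝ≥0∞) : Prop :=
  ∀ ε : ℝ, 0 < ε → Tendsto (fun T => P T {ω | ENNReal.ofReal ε ≤ X T ω}) atTop (𝓝 0)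

/-! Put c = h 0 / h 1 and f l = z √(arVariance V l) / (|h 1| √T), with z the normal quantile. The
plug-in interval is |l - c| ≤ f c and the Anderson-Rubin set is |l - c| ≤ f l: they differ only in
where the standard error is evaluated. As √(arVariance V ·) is a seminorm along a line, f is
Lipschitz with constant κ = z √(V 1 1) / (|h 1| √T), so the Hausdorff distance is at most 2 κ f c.
Both factors are O(T^(-1/2)), hence √T times the distance is O(T^(-1/2)).

The constants must be uniform with probability tending to one. Relevance keeps |h 1| away from 0;
the bound of covariances by variances keeps h 0 bounded, although only coordinate 0 of `Γ T` is
assumed to converge; consistency at l = 0, 1, -1 bounds the estimated quadratic form. -/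

/-- Hausdorff comparison of the level set `{l | |l - c| ≤ f l}` of a slowly varying `f` with
the interval of radius `f c`. -/
lemma hausdorffEDist_setOf_abs_sub_le {f : ℝ → ℝ} {c κ : ℝ} (hκ0 : 0 ≤ κ) (hκ : κ ≤ 1 / 2)
    (hf : ∀ l m, f l ≤ f m + κ * |l - m|) :
    Metric.hausdorffEDist {l | |l - c| ≤ f l} (Set.Icc (c - f c) (c + f c)) ≤
      ENNReal.ofReal (2 * κ * f c) := by
  -- both directions contract towards `c` by the factor `1 - κ`
  have hdist : ∀ l, edist l (c + (1 - κ) * (l - c)) = ENNReal.ofReal (κ * |l - c|) := fun l => by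
    rw [edist_dist, Real.dist_eq]
    congr 1
    rw [show l - (c + (1 - κ) * (l - c)) = κ * (l - c) by ring, abs_mul, abs_of_nonneg hκ0]
  have habs : ∀ l, |c + (1 - κ) * (l - c) - c| = (1 - κ) * |l - c| := fun l => by
    rw [add_sub_cancel_left, abs_mul, abs_of_nonneg (by linarith)]
  refine Metric.hausdorffEDist_le_of_mem_edist (fun l hl => ?_) (fun l hl => ?_)
  · have hl' : |l - c| ≤ f l := hl
    have h1 := hf l c
    have h2 : (1 - κ) * |l - c| ≤ f c := by linarith
    refine ⟨c + (1 - κ) * (l - c), ?_, ?_⟩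
    · have := habs l ▸ h2
      rw [abs_le] at this
      constructor <;> linarith
    · rw [hdist]
      refine ENNReal.ofReal_le_ofReal ?_
      -- This is where κ ≤ 1/2 enters: 1 / (1 - κ) ≤ 2.
      have h3 : |l - c| ≤ 2 * f c := by nlinarith [abs_nonneg (l - c)]
      nlinarith
  · have hl' : |l - c| ≤ f c := by
      rw [abs_le]
      constructor <;> linarith [hl.1, hl.2]
    have h0 := abs_nonneg (l - c)
    refine ⟨c + (1 - κ) * (l - c), ?_, ?_⟩
    · have h1 := hf c (c + (1 - κ) * (l - c))
      rw [abs_sub_comm, habs] at h1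
      rw [Set.mem_ofPred_eq, habs]
      nlinarith [mul_nonneg (mul_nonneg hκ0 hκ0) h0]
    · rw [hdist]
      exact ENNReal.ofReal_le_ofReal (by nlinarith)

/-! ### Quadratic forms of positive semidefinite 2 × 2 matrices. -/

section Variance

variable {V : Matrix (Fin 2) (Fin 2) ℝ}

lemma arVariance_eq (V : Matrix (Fin 2) (Fin 2) ℝ) (l : ℝ) :
    arVariance V l = V 0 0 - l * (V 0 1 + V 1 0) + l ^ 2 * V 1 1 := by
  simp [arVariance, Matrix.mulVec, dotProduct, Fin.sum_univ_two]
  ring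

lemma arVariance_nonneg (hV : V.PosSemidef) (l : ℝ) : 0 ≤ arVariance V l := by
  simpa [arVariance] using hV.dotProduct_mulVec_nonneg ![1, -l]

lemma deltaVariance_eq (V : Matrix (Fin 2) (Fin 2) ℝ) {h : EuclideanSpace ℝ (Fin 2)}
    (h1 : h 1 ≠ 0) : deltaVariance V h = arVariance V (h 0 / h 1) / h 1 ^ 2 := by
  rw [arVariance_eq]
  simp [deltaVariance, Matrix.mulVec, dotProduct, Fin.sum_univ_two]
  field_simp
  ring

/-- Triangle inequality for the seminorm `√(x' V x)` on the line of vectors `(1, -l)`. -/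
lemma sqrt_arVariance_le (hV : V.PosSemidef) (l m : ℝ) :
    √(arVariance V l) ≤ √(arVariance V m) + √(V 1 1) * |l - m| := by
  have hs : V 1 0 = V 0 1 := by simpa using hV.isHermitian.apply 0 1
  have hd : 0 ≤ V 1 1 := hV.diag_nonneg
  have hdet : 0 ≤ V 0 0 * V 1 1 - V 0 1 * V 0 1 := by
    have := hV.det_nonneg
    rwa [Matrix.det_fin_two, hs] at this
  have hm := arVariance_nonneg hV m
  -- Cauchy-Schwarz for (1, -m) and (0, 1); the difference of the squares is det V.
  have hcross : |V 1 1 * m - V 0 1| ≤ √(arVariance V m) * √(V 1 1) := by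
    rw [← Real.sqrt_mul hm]
    refine Real.abs_le_sqrt ?_
    rw [arVariance_eq, hs]
    nlinarith
  have hprod : (V 1 1 * m - V 0 1) * (l - m) ≤ √(arVariance V m) * √(V 1 1) * |l - m| := by
    refine (le_abs_self _).trans ?_
    rw [abs_mul]
    gcongr
  refine Real.sqrt_le_iff.2 ⟨by positivity, ?_⟩
  have e : arVariance V l =
      arVariance V m + 2 * ((V 1 1 * m - V 0 1) * (l - m)) + V 1 1 * (l - m) ^ 2 := by
    simp only [arVariance_eq, hs]
    ring
  rw [e, add_sq, mul_pow, Real.sq_sqrt hm, Real.sq_sqrt hd, sq_abs]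
  linarith

/-- The cross terms cancel in the sum of the two values, which is 2 (V 0 0 + V 1 1). -/
lemma apply_one_one_le (hV : V.PosSemidef) {K : ℝ} (h1 : arVariance V 1 ≤ K)
    (h2 : arVariance V (-1) ≤ K) : V 1 1 ≤ K := by
  have hd : 0 ≤ V 0 0 := hV.diag_nonneg
  rw [arVariance_eq] at h1 h2
  linarith

/-- Parallelogram law for l and -l. It serves at the random point h 0 / h 1, where consistency at
fixed l does not apply directly. -/
lemma arVariance_le (hV : V.PosSemidef) (l : ℝ) :
    arVariance V l ≤ 2 * arVariance V 0 + 2 * (l ^ 2 * V 1 1) := by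
  have := arVariance_nonneg hV (-l)
  rw [arVariance_eq] at *
  rw [arVariance_eq]
  linarith

end Variance

/-- A negative z in the defining set would give two disjoint tails, symmetric about 0, each of mass
above 1/2. -/
lemma normalQuantile_nonneg {p : ℝ} (hp : 1 / 2 < p) : 0 ≤ normalQuantile p := by
  refine Real.sInf_nonneg fun z hz => ?_
  by_contra! hneg
  have hz' : p ≤ (gaussianReal 0 1).real (Set.Iic z) := by
    rw [← cdf_eq_real]
    exact hz
  have hsymm : (gaussianReal 0 1).real (Set.Ici (-z)) = (gaussianReal 0 1).real (Set.Iic z) := by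
    have h := gaussianReal_map_neg (μ := 0) (v := 1)
    rw [neg_zero] at h
    nth_rewrite 2 [← h]
    rw [map_measureReal_apply measurable_neg measurableSet_Iic]
    congr 1
    ext x
    simp
  have hdisj : Disjoint (Set.Iic z) (Set.Ici (-z)) :=
    Set.disjoint_left.2 fun x hx hx' => by
      simp only [Set.mem_Iic, Set.mem_Ici] at hx hx'
      linarith
  have hsum := measureReal_union (μ := gaussianReal 0 1) hdisj measurableSet_Ici
  have hle := measureReal_le_one (μ := gaussianReal 0 1) (s := Set.Iic z ∪ Set.Ici (-z))
  linarith

/-- Nonasymptotic bound on the distance between the two confidence sets. -/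
lemma hausdorffEDist_arSet_plugInSet_le {T : ℕ} (hT : 0 < T) {α : ℝ}
    (hz : 0 ≤ normalQuantile (1 - α / 2)) {h : EuclideanSpace ℝ (Fin 2)} (h1 : h 1 ≠ 0)
    {V : Matrix (Fin 2) (Fin 2) ℝ} (hV : V.PosSemidef)
    (hκ : normalQuantile (1 - α / 2) * √(V 1 1) / (|h 1| * √(T : ℝ)) ≤ 1 / 2) :
    ENNReal.ofReal √(T : ℝ) * Metric.hausdorffEDist (arSet T α h V) (plugInSet T α h V) ≤
      ENNReal.ofReal (2 * normalQuantile (1 - α / 2) ^ 2 * √(V 1 1) *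
        √(arVariance V (h 0 / h 1)) / (|h 1| ^ 2 * √(T : ℝ))) := by
  have hT' : 0 < √(T : ℝ) := Real.sqrt_pos.2 (Nat.cast_pos.2 hT)
  have ha : 0 < |h 1| := abs_pos.2 h1
  set z := normalQuantile (1 - α / 2) with hzdef
  set f : ℝ → ℝ := fun l => z * √(arVariance V l) / (|h 1| * √(T : ℝ)) with hfdef
  have hAR : arSet T α h V = {l | |l - h 0 / h 1| ≤ f l} := by
    ext l
    have e : (√(T : ℝ) * (h 0 - l * h 1)) ^ 2 = (|l - h 0 / h 1| * (|h 1| * √(T : ℝ))) ^ 2 := by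
      simp only [mul_pow, sq_abs]
      field_simp
      ring
    rw [arSet, Set.mem_ofPred_eq, Set.mem_ofPred_eq, e, ← hzdef, hfdef, le_div_iff₀ (by positivity),
      ← Real.sq_sqrt (arVariance_nonneg hV l), ← mul_pow,
      Real.sqrt_sq (Real.sqrt_nonneg _)]
    exact pow_le_pow_iff_left₀ (by positivity) (by positivity) two_ne_zero
  have hPI : plugInSet T α h V =
      Set.Icc (h 0 / h 1 - f (h 0 / h 1)) (h 0 / h 1 + f (h 0 / h 1)) := by
    have e : z * √(deltaVariance V h) / √(T : ℝ) = f (h 0 / h 1) := by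
      rw [deltaVariance_eq V h1, Real.sqrt_div (arVariance_nonneg hV _), Real.sqrt_sq_eq_abs, hfdef]
      field_simp
    rw [plugInSet, ← hzdef, e]
  have hlip : ∀ l m, f l ≤ f m + z * √(V 1 1) / (|h 1| * √(T : ℝ)) * |l - m| := fun l m => by
    have := mul_le_mul_of_nonneg_left (sqrt_arVariance_le hV l m) hz
    calc f l ≤ z * (√(arVariance V m) + √(V 1 1) * |l - m|) / (|h 1| * √(T : ℝ)) := by
          simp only [hfdef]
          gcongr
      _ = _ := by
          simp only [hfdef]
          ring
  rw [hAR, hPI]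
  refine (mul_le_mul_right (hausdorffEDist_setOf_abs_sub_le (by positivity) hκ hlip) _).trans ?_
  rw [← ENNReal.ofReal_mul hT'.le]
  refine ENNReal.ofReal_le_ofReal (le_of_eq ?_)
  simp only [hfdef]
  field_simp

/-! ### Convergence in probability and moment bounds. -/

section Probability

/-- Variables that converge in distribution after multiplication by diverging factors tend to zero
in probability. -/
lemma tendsto_measure_le_norm_of_tendstoInDistribution {E Ω' : Type*} [NormedAddCommGroup E]
    [NormedSpace ℝ E] [MeasurableSpace E] [BorelSpace E] {Ω : ℕ → Type*}
    [∀ n, MeasurableSpace (Ω n)] {P : ∀ n, Measure (Ω n)} [∀ n, IsProbabilityMeasure (P n)]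
    [MeasurableSpace Ω'] {Q : Measure Ω'} [IsProbabilityMeasure Q] {Y : Ω' → E}
    {r : ℕ → ℝ} (hr : Tendsto r atTop atTop) {X : ∀ n, Ω n → E}
    (h : TendstoInDistribution (fun n ω => r n • X n ω) atTop Y P Q) {η : ℝ} (hη : 0 < η) :
    Tendsto (fun n => P n {ω | η ≤ ‖X n ω‖}) atTop (𝓝 0) := by
  -- Tightness of the limit law; the portmanteau theorem for closed sets then transfers a small tail
  -- to large n.
  have htail : Tendsto (fun M : ℕ => (Q.map Y) {x | (M : ℝ) ≤ ‖x‖}) atTop (𝓝 0) := by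
    have : IsProbabilityMeasure (Q.map Y) :=
      Measure.isProbabilityMeasure_map h.aemeasurable_limit
    have hempty : ⋂ M : ℕ, {x : E | (M : ℝ) ≤ ‖x‖} = ∅ := by
      ext x
      obtain ⟨M, hM⟩ := exists_nat_gt ‖x‖
      simpa using ⟨M, hM⟩
    rw [← measure_empty (μ := Q.map Y), ← hempty]
    refine tendsto_measure_iInter_atTop
      (fun M => (isClosed_le continuous_const continuous_norm).measurableSet.nullMeasurableSet)
      (fun M M' hM x hx => ?_) ⟨0, measure_ne_top _ _⟩
    rw [Set.mem_ofPred_eq] at hx ⊢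
    exact (Nat.cast_le.2 hM).trans hx
  rw [ENNReal.tendsto_nhds_zero]
  intro ε hε
  obtain ⟨M, hM⟩ := (htail.eventually (gt_mem_nhds hε)).exists
  have hclosed : IsClosed {x : E | (M : ℝ) ≤ ‖x‖} := isClosed_le continuous_const continuous_norm
  have hlim := (ProbabilityMeasure.limsup_measure_closed_le_of_tendsto h.tendsto hclosed).trans_lt hM
  filter_upwards [eventually_lt_of_limsup_lt hlim, hr.eventually_ge_atTop (M / η),
    hr.eventually_gt_atTop 0] with n hn hrn hr0
  refine le_trans ?_ hn.le
  simp only [ProbabilityMeasure.coe_mk]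
  rw [Measure.map_apply_of_aemeasurable (h.forall_aemeasurable n) hclosed.measurableSet]
  refine measure_mono fun ω hω => ?_
  have hω' : η ≤ ‖X n ω‖ := hω
  simp only [Set.mem_preimage, Set.mem_ofPred_eq, norm_smul, Real.norm_of_nonneg hr0.le]
  calc (M : ℝ) ≤ r n * η := (div_le_iff₀ hη).1 hrn
    _ ≤ r n * ‖X n ω‖ := by gcongr

/-- The variances of X + Y and X - Y are nonnegative. -/
lemma two_mul_abs_covariance_le {Ω : Type*} [MeasurableSpace Ω] {P : Measure Ω}
    [IsProbabilityMeasure P] {X Y : Ω → ℝ} (hX : MemLp X 2 P) (hY : MemLp Y 2 P) :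
    2 * |covariance X Y P| ≤ variance X P + variance Y P := by
  have h1 := variance_add hX hY
  have h2 := variance_sub hX hY
  have h3 := variance_nonneg (X + Y) P
  have h4 := variance_nonneg (X - Y) P
  rcases abs_cases (covariance X Y P) with h | h <;> linarith

lemma Panel.HasStationaryMoments.two_mul_abs_le {N J T : ℕ} (hN : 0 < N) (hT : 0 < T) {Ω : Type*}
    [MeasurableSpace Ω] {D : Panel N J T Ω} {P : Measure Ω} [IsProbabilityMeasure P]
    {Φ : Matrix (Fin (J + 1)) (Fin (J + 1)) ℝ} {μ : Fin N → Fin (J + 1) → ℝ}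
    {Sig : Matrix (Fin (J + 1)) (Fin (J + 1)) ℝ} {Γ : Fin (J + 1) → ℝ} {v : ℝ}
    (h : D.HasStationaryMoments P Φ μ Sig Γ v) (a : Fin (J + 1)) :
    2 * |Γ a| ≤ v + Sig a a := by
  let i : Fin N := ⟨0, hN⟩
  let t : Fin T := ⟨0, hT⟩
  have hm := h.memLp_innovation i t a
  rw [← h.cov_Z i t a, ← h.var_Z i t, ← h.cov_innovation i t a a,
    covariance_self hm.aemeasurable]
  exact two_mul_abs_covariance_le (h.memLp_Z i t) hm

/-- Covariances dominated by convergent variances give bounded numerators of the impulse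
responses. -/
lemma exists_eventually_abs_mulVec_le {ι : Type*} [Fintype ι] {Sig : ℕ → Matrix ι ι ℝ}
    {SigLim : Matrix ι ι ℝ} (hSig : Tendsto Sig atTop (𝓝 SigLim)) {Γ : ℕ → ι → ℝ} {v : ℝ}
    (hΓ : ∀ᶠ T in atTop, ∀ a, 2 * |Γ T a| ≤ v + Sig T a a) (A : Matrix ι ι ℝ) (s : ι) :
    ∃ B, ∀ᶠ T in atTop, |(A *ᵥ Γ T) s| ≤ B := by
  have hlim : Tendsto (fun T => ∑ a, |A s a| * ((v + Sig T a a) / 2)) atTop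
      (𝓝 (∑ a, |A s a| * ((v + SigLim a a) / 2))) := by
    refine tendsto_finsetSum _ fun a _ => ?_
    have ha : Tendsto (fun T => Sig T a a) atTop (𝓝 (SigLim a a)) :=
      ((tendsto_pi_nhds.1 ((tendsto_pi_nhds.1 hSig) a)) a)
    exact ((ha.const_add v).div_const 2).const_mul _
  refine ⟨∑ a, |A s a| * ((v + SigLim a a) / 2) + 1, ?_⟩
  filter_upwards [hΓ, hlim.eventually (gt_mem_nhds (lt_add_one _))] with T hT hb
  refine le_trans ?_ hb.le
  refine (Finset.abs_sum_le_sum_abs _ _).trans (Finset.sum_le_sum fun a _ => ?_)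
  rw [abs_mul]
  gcongr
  linarith [hT a]

end Probability

/-! ### The main theorem: bounds on good events. -/

theorem mainTheorem4
    {N J : ℕ} (hN : 1 ≤ N) (s : Fin (J + 1)) (k : ℕ) (α : ℝ) (hα : α ∈ Set.Ioo (0 : ℝ) 1)
    -- the panels, the one of length `T` being drawn from the distribution `P T`
    {Ω : ℕ → Type*} [∀ T, MeasurableSpace (Ω T)] (P : ∀ T, Measure (Ω T))
    [∀ T, IsProbabilityMeasure (P T)]
    (D : ∀ T, Panel N J T (Ω T))
    (Φ : Matrix (Fin (J + 1)) (Fin (J + 1)) ℝ) (μ : ℕ → Fin N → Fin (J + 1) → ℝ)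
    (hD : ∀ T, (D T).IsPotentialOutcomeModel (P T) Φ (μ T))
    (Sig : ℕ → Matrix (Fin (J + 1)) (Fin (J + 1)) ℝ) (Γ : ℕ → Fin (J + 1) → ℝ) (v : ℝ)
    (hmom : ∀ T, (D T).HasStationaryMoments (P T) Φ (μ T) (Sig T) (Γ T) v)
    -- independence, exclusion, monotonicity
    (hindep : ∀ T, (D T).Independence (P T))
    (hexcl : ∀ T, (D T).Exclusion (P T))
    (hmono : ∀ T, (D T).Monotonicity (P T))
    -- convergence of the first-stage covariance, and relevance
    (δ : ℝ) (hδ : Tendsto (fun T => Γ T 0) atTop (𝓝 δ)) (hrel : δ ≠ 0)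
    -- convergence of the covariance matrix of the innovations
    (SigLim : Matrix (Fin (J + 1)) (Fin (J + 1)) ℝ) (hSig : Tendsto Sig atTop (𝓝 SigLim))
    -- estimators of `Φ` and `Γ T`, and asymptotic normality of the plug-in estimator
    (Φhat : ∀ T, PanelSample N J T → Matrix (Fin (J + 1)) (Fin (J + 1)) ℝ)
    (Γhat : ∀ T, PanelSample N J T → Fin (J + 1) → ℝ)
    (V : Matrix (Fin 2) (Fin 2) ℝ) (hV : V.PosSemidef)
    (hnormal : TendstoInDistribution
      (fun (T : ℕ) (ω : Ω T) => √(T : ℝ) • (irfPair s k (Φhat T ((D T).sample ω)) (Γhat T ((D T).sample ω))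
        - irfPair s k Φ (Γ T)))
      atTop (id : EuclideanSpace ℝ (Fin 2) → EuclideanSpace ℝ (Fin 2)) P
      (multivariateGaussian 0 V))
    -- estimator of the asymptotic covariance matrix, and consistency of the variance estimator
    (Vhat : ∀ T, PanelSample N J T → Matrix (Fin 2) (Fin 2) ℝ)
    (hVhat : ∀ T d, (Vhat T d).PosSemidef)
    (hcons : ∀ l : ℝ, TendstoInProbZero P
      (fun T ω => edist (arVariance (Vhat T ((D T).sample ω)) l) (arVariance V l))) :
    TendstoInProbZero P (fun T ω => ENNReal.ofReal √(T : ℝ) *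
      Metric.hausdorffEDist
        (arSet T α (irfPair s k (Φhat T ((D T).sample ω)) (Γhat T ((D T).sample ω)))
          (Vhat T ((D T).sample ω)))
        (plugInSet T α (irfPair s k (Φhat T ((D T).sample ω)) (Γhat T ((D T).sample ω)))
          (Vhat T ((D T).sample ω)))) := by
  have hz : 0 ≤ normalQuantile (1 - α / 2) := normalQuantile_nonneg (by linarith [hα.2])
  obtain ⟨B, hB⟩ := exists_eventually_abs_mulVec_le hSig (Γ := Γ) (v := v)
    ((eventually_gt_atTop 0).mono fun T hT a => (hmom T).two_mul_abs_le hN hT a) (Φ ^ k) s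
  have hδ0 : 0 < |δ| := abs_pos.2 hrel
  have hsqrt : Tendsto (fun T : ℕ => √(T : ℝ)) atTop atTop :=
    Real.tendsto_sqrt_atTop.comp tendsto_natCast_atTop_atTop
  set z := normalQuantile (1 - α / 2) with hzdef
  -- uniform bounds, valid with probability tending to one
  set c := |δ| / 4 with hc
  have hc0 : 0 < c := by positivity
  set K := max (arVariance V 0) (max (arVariance V 1) (arVariance V (-1))) + 1 with hK
  have hK0 : 0 ≤ K := by
    have h0 := arVariance_nonneg hV 0
    have h1 := le_max_left (arVariance V 0) (max (arVariance V 1) (arVariance V (-1)))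
    linarith
  -- Bound for the variance at h 0 / h 1, from |h 0| ≤ |B| + c and |h 1| ≥ c.
  set Q := 2 * K + 2 * (((|B| + c) / c) ^ 2 * K) with hQ
  have hbound : Tendsto (fun T : ℕ => 2 * z ^ 2 * √K * √Q / (c ^ 2 * √(T : ℝ))) atTop (𝓝 0) :=
    tendsto_const_nhds.div_atTop (hsqrt.const_mul_atTop (by positivity))
  have hcontr : Tendsto (fun T : ℕ => z * √K / (c * √(T : ℝ))) atTop (𝓝 0) :=
    tendsto_const_nhds.div_atTop (hsqrt.const_mul_atTop hc0)
  intro ε hε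
  have hbadH := tendsto_measure_le_norm_of_tendstoInDistribution hsqrt hnormal hc0
  have hbad := ((hbadH.add (hcons 0 1 one_pos)).add (hcons 1 1 one_pos)).add (hcons (-1) 1 one_pos)
  simp only [add_zero] at hbad
  refine tendsto_of_tendsto_of_tendsto_of_le_of_le' tendsto_const_nhds hbad
    (Eventually.of_forall fun _ => zero_le) ?_
  filter_upwards [hB, hbound.eventually (gt_mem_nhds hε),
    hcontr.eventually (gt_mem_nhds one_half_pos), eventually_gt_atTop 0,
    hδ.abs.eventually (lt_mem_nhds (half_lt_self hδ0))] with T hBT hεT hκT hT hΓT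
  -- The event of a large distance lies in the union of four bad events: outside them the
  -- deterministic bound is below ε.
  refine le_trans (measure_mono fun ω hω => ?_) ((measure_union_le _ _).trans
    (add_le_add_left ((measure_union_le _ _).trans
      (add_le_add_left (measure_union_le _ _) _)) _))
  by_contra hgood
  simp only [Set.mem_union, Set.mem_ofPred_eq, not_or, not_le, ENNReal.ofReal_one] at hgood hω
  obtain ⟨⟨⟨hH, hv0⟩, hv1⟩, hv2⟩ := hgood
  have hPSD := hVhat T ((D T).sample ω)
  set W := Vhat T ((D T).sample ω) with hW
  set h := irfPair s k (Φhat T ((D T).sample ω)) (Γhat T ((D T).sample ω)) with hh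
  have hle : ∀ l, edist (arVariance W l) (arVariance V l) < 1 →
      arVariance W l ≤ arVariance V l + 1 := fun l hl => by
    rw [edist_dist, ← ENNReal.ofReal_one, ENNReal.ofReal_lt_ofReal_iff one_pos,
      Real.dist_eq] at hl
    linarith [(abs_lt.1 hl).2]
  have hW0 : arVariance W 0 ≤ K := (hle 0 hv0).trans (by rw [hK]; gcongr; simp)
  have hW1 : arVariance W 1 ≤ K := (hle 1 hv1).trans (by rw [hK]; gcongr; simp)
  have hW2 : arVariance W (-1) ≤ K := (hle (-1) hv2).trans (by rw [hK]; gcongr; simp)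
  have hd : W 1 1 ≤ K := apply_one_one_le hPSD hW1 hW2
  have hh0 : |h 0| ≤ |B| + c := by
    have h1 := (PiLp.norm_apply_le (h - irfPair s k Φ (Γ T)) 0).trans hH.le
    have e : (h - irfPair s k Φ (Γ T)) 0 = h 0 - (Φ ^ k *ᵥ Γ T) s := by simp [irfPair]
    rw [e, Real.norm_eq_abs] at h1
    linarith [abs_sub_abs_le_abs_sub (h 0) ((Φ ^ k *ᵥ Γ T) s), le_abs_self B]
  have hh1 : c ≤ |h 1| := by
    have h1 := (PiLp.norm_apply_le (h - irfPair s k Φ (Γ T)) 1).trans hH.le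
    have e : (h - irfPair s k Φ (Γ T)) 1 = h 1 - Γ T 0 := by simp [irfPair]
    rw [e, Real.norm_eq_abs, abs_sub_comm] at h1
    linarith [abs_sub_abs_le_abs_sub (Γ T 0) (h 1)]
  have hratio : (h 0 / h 1) ^ 2 ≤ ((|B| + c) / c) ^ 2 := by
    rw [← sq_abs (h 0 / h 1), abs_div]
    gcongr
  have hq : arVariance W (h 0 / h 1) ≤ Q := by
    refine (arVariance_le hPSD _).trans ?_
    rw [hQ]
    gcongr
    exact hPSD.diag_nonneg
  have hT' : 0 < √(T : ℝ) := Real.sqrt_pos.2 (Nat.cast_pos.2 hT)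
  have hfinal := hausdorffEDist_arSet_plugInSet_le hT hz (abs_pos.1 (hc0.trans_le hh1)) hPSD
    (le_trans (by gcongr) hκT.le)
  refine absurd (hω.trans hfinal) (not_le.2 ?_)
  rw [ENNReal.ofReal_lt_ofReal_iff hε]
  exact lt_of_le_of_lt (by gcongr) hεT
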